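/- Let $(\mathcal S,\mathcal A,H,\alpha,P,r)$ be a finite episodic Markov decision process: finite state set $\mathcal S$, finite nonempty action set $\mathcal A$, episode length $H$, initial distribution $\alpha$, transition probabilities $P_h(y\mid x,a)$ and deterministic rewards $r_h(x,a)\in[0,1]$ for $h=1,\dots,H$. A policy is a family $\pi=(\pi_h)_{h=1}^H$ of maps $\mathcal S\to\mathcal A$; $V_1^\pi(x)$ is the expected total reward of an episode started in $x$ under $\pi$, and $V_1^*(x)=\max_\pi V_1^\pi(x)$. A learner interacts with the process for $K$ episodes; write $T=KH$. In episode $t$ it follows a policy $\pi_t$ chosen from the information available before that episode; the initial state $x_{1,t}$ has law $\alpha$ given that information, and, given everything observed up to stage $h$, the next state $x_{h+1,t}$ has law $P_h(\cdot\mid x_{h,t},\pi_{t,h}(x_{h,t}))$. The regret is $\mathrm{Reg}_T=\sum_{t=1}^K\bigl(V_1^*(x_{1,t})-V_1^{\pi_t}(x_{1,t})\bigr)$. Before episode $t$ the learner fixes, as (measurable) functions of the information available then, a real-valued reference function $\widehat P_{h,t}(y\mid x,a)$ (for instance the empirical transition frequencies), aggregation functions $w_{h,i,t}:\mathcal S\to\mathbb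 R$ and widths $b_{h,i,t}:\mathcal S\times\mathcal A\to\mathbb R$, where $i$ ranges over a finite set $\mathcal I$. Let $\mathcal P_t$ be the set of transition functions $p$ such that $\sum_y w_{h,i,t}(y)\,|p_h(y\mid x,a)-\widehat P_{h,t}(y\mid x,a)|\le b_{h,i,t}(x,a)$ for all $h,i,x,a$. Consider the optimistic linear program: maximize $\sum_{h,x,a,y}q_h(x,a,y)\,r_h(x,a)$ over $q,\varepsilon\ge0$ such that $q$ satisfies the initial and flow constraints of an occupancy measure, $|q_h(x,a,y)-\widehat P_{h,t}(y\mid x,a)\sum_z q_h(x,a,z)|\le\varepsilon_h(x,a,y)$ and $\sum_y w_{h,i,t}(y)\varepsilon_h(x,a,y)\le b_{h,i,t}(x,a)\sum_z q_h(x,a,z)$. The constraints of its dual at $(h,x,a)$ are $$\beta_h(x)\ \ge\ r_h(x,a)+\beta_{h+1}(y)+\sum_z\widehat P_{h,t}(z\mid x,a)\bigl(\mu^+(z)-\mu^-(z)\bigr)-\bigl(\mu^+(y)-\mu^-(y)\bigr)+\sum_i b_{h,i,t}(x,a)\mu_i\quad(y\in\mathcal S),$$ with multipliers $\mu^+,\mu^-,\mu\ge0$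 (depending on $h,x,a$) subject to $\mu^+(y)+\mu^-(y)\le\sum_i w_{h,i,t}(y)\mu_i$ for all $y$, and $\beta_{H+1}=0$. Eliminating the multipliers turns them into $\beta_h(x)\ge r_h(x,a)+\mathrm{CB}_{h,t}(x,a)+\sum_y\widehat P_{h,t}(y\mid x,a)\beta_{h+1}(y)$, where the exploration bonus $\mathrm{CB}_{h,t}(x,a)$ is the least $z\in\mathbb R$ such that, for some admissible multipliers, the constraints above hold with $r_h(x,a)+z+\sum_y\widehat P_{h,t}(y\mid x,a)\beta_{h+1}(y)$ in place of $\beta_h(x)$. Let $\beta^*_t$ be the solution computed by dynamic programming, $\beta^*_{H+1,t}=0$ and $$\beta^*_{h,t}(x)=\max_{a\in\mathcal A}\Bigl\{r_h(x,a)+\mathrm{CB}_{h,t}(x,a)+\sum_y\widehat P_{h,t}(y\mid x,a)\,\beta^*_{h+1,t}(y)\Bigr\},$$ with $\mathrm{CB}_{h,t}$ formed from $\beta_{h+1}=\beta^*_{h+1,t}$. Whenever $\mathcal P_t\ne\emptyset$, the policy $\pi_t$ attains this maximum at every $h$ and $x$. Put $\mathrm{CP}_{h,t}(x,a)=\sum_y\bigl(\widehat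 P_{h,t}(y\mid x,a)-P_h(y\mid x,a)\bigr)\beta^*_{h+1,t}(y)$. Then for every $\delta\in(0,1]$ there is an event $G$ of probability at least $1-2\delta$ such that on $G\cap\bigcap_{t=1}^K\{P\in\mathcal P_t\}$ $$\mathrm{Reg}_T\ \le\ \sum_{t=1}^K\sum_{h=1}^H\mathrm{CB}_{h,t}\bigl(x_{h,t},\pi_{t,h}(x_{h,t})\bigr)+\sum_{t=1}^K\sum_{h=1}^H\mathrm{CP}_{h,t}\bigl(x_{h,t},\pi_{t,h}(x_{h,t})\bigr)+2H\sqrt{2T\log(1/\delta)} .$$ -/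

import Mathlib

open MeasureTheory

noncomputable section

/-- A finite episodic Markov decision process with episode length `H`. Stages are indexed from `0`:
the index `h : Fin H` is the stage called `h + 1` in `1, …, H`. -/
structure EpisodicMDP (S A : Type*) [Fintype S] (H : ℕ) where
  /-- distribution of the initial state -/
  initial : S → ℝ
  initial_mem : initial ∈ stdSimplex ℝ S
  /-- `trans h x a y` is the probability `P_h(y | x, a)` -/
  trans : Fin H → S → A → S → ℝ
  trans_mem : ∀ h x a, trans h x a ∈ stdSimplex ℝ S
  /-- deterministic reward `r_h(x, a)` -/
  reward : Fin H → S → A → ℝ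
  reward_mem : ∀ h x a, reward h x a ∈ Set.Icc (0 : ℝ) 1

/-- The parameters of the optimistic linear program of one episode: the reference transition
function `P̂`, the constraint-aggregation functions `w` and the confidence widths `b`. No sign or
normalization is imposed; in particular the empirical frequencies, whose rows vanish at pairs that
were never visited, are allowed as `ref`. -/
structure ConfidenceData (S A I : Type*) (H : ℕ) where
  ref : Fin H → S → A → S → ℝ
  weight : Fin H → I → S → ℝ
  width : Fin H → I → S → A → ℝ

namespace EpisodicMDP

variable {S A : Type*} [Fintype S] {H : ℕ}

open Classical in
/-- The value `V_1^π(x)`: the expectation of the total reward of one episode under the policy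
`π = (π_h)_h` when the initial state is `x`, as a sum over all state trajectories that start
in `x` (the last coordinate of a trajectory is the state reached after the last stage). -/
def value (M : EpisodicMDP S A H) (π : Fin H → S → A) (x : S) : ℝ :=
  ∑ τ : Fin (H + 1) → S with τ 0 = x,
    (∏ h : Fin H, M.trans h (τ h.castSucc) (π h (τ h.castSucc)) (τ h.succ)) *
      ∑ h : Fin H, M.reward h (τ h.castSucc) (π h (τ h.castSucc))

/-- The optimal value `V_1^*(x) = max_π V_1^π(x)`; the set of policies is finite. -/
def optValue (M : EpisodicMDP S A H) (x : S) : ℝ :=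
  ⨆ π : Fin H → S → A, M.value π x

end EpisodicMDP

namespace ConfidenceData

variable {S A I : Type*} [Fintype S] [Fintype I] {H : ℕ}

/-- The confidence set: all transition functions `p` with
`∑_y w_{h,i}(y) |p_h(y|x,a) - P̂_h(y|x,a)| ≤ b_{h,i}(x,a)` for all `h, i, x, a`. -/
def confidenceSet (D : ConfidenceData S A I H) : Set (Fin H → S → A → S → ℝ) :=
  {p | (∀ h x a, p h x a ∈ stdSimplex ℝ S) ∧
    ∀ h i x a, ∑ y, D.weight h i y * |p h x a y - D.ref h x a y| ≤ D.width h i x a}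

/-- The constraints of the dual of the optimistic linear program

  maximize `∑ q_h(x,a,y) r_h(x,a)` over flows `q ≥ 0` and slacks `ε ≥ 0` subject to
  `|q_h(x,a,y) - P̂_h(y|x,a) ∑_z q_h(x,a,z)| ≤ ε_h(x,a,y)` and
  `∑_y w_{h,i}(y) ε_h(x,a,y) ≤ b_{h,i}(x,a) ∑_z q_h(x,a,z)`

that involve the pair `(x, a)` at stage `h`. Here `v` stands for `β_h(x)`, `β'` for `β_{h+1}`, and
`μp, μm, μ` are the multipliers of the two halves of the first and of the second constraint. -/
def DualConstraint (M : EpisodicMDP S A H) (D : ConfidenceData S A I H) (h : Fin H) (x : S) (a : A)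
    (v : ℝ) (β' : S → ℝ) (μp μm : S → ℝ) (μ : I → ℝ) : Prop :=
  (∀ y, 0 ≤ μp y) ∧ (∀ y, 0 ≤ μm y) ∧ (∀ i, 0 ≤ μ i) ∧
  (∀ y, μp y + μm y ≤ ∑ i, D.weight h i y * μ i) ∧
  ∀ y, M.reward h x a ≤ v - β' y - ∑ z, D.ref h x a z * (μp z - μm z) + (μp y - μm y)
    - ∑ i, D.width h i x a * μ i

/-- The exploration bonus `CB_h(x,a)` for the next-stage values `β' = β_{h+1}`: the least `z` such
that `β_h(x) = r_h(x,a) + z + ∑_y P̂_h(y|x,a) β_{h+1}(y)` meets the dual constraints at `(h,x,a)`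
for some choice of the multipliers. Thus, after elimination of the multipliers, the dual constraints
read `β_h(x) ≥ r_h(x,a) + CB_h(x,a) + ∑_y P̂_h(y|x,a) β_{h+1}(y)`. -/
def bonusOf (M : EpisodicMDP S A H) (D : ConfidenceData S A I H) (h : Fin H) (x : S) (a : A)
    (β' : S → ℝ) : ℝ :=
  sInf {z | ∃ (μp μm : S → ℝ) (μ : I → ℝ),
    D.DualConstraint M h x a (M.reward h x a + z + ∑ y, D.ref h x a y * β' y) β' μp μm μ}

/-- The optimistic value function `β^*` computed by dynamic programming: `β^*_{H+1} = 0` and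
`β^*_h(x) = max_a (r_h(x,a) + CB_h(x,a) + ∑_y P̂_h(y|x,a) β^*_{h+1}(y))`.
The index `h.castSucc` is stage `h`, the index `h.succ` the stage after it. -/
def optimisticValue [Fintype A] [Nonempty A] (M : EpisodicMDP S A H) (D : ConfidenceData S A I H) :
    Fin (H + 1) → S → ℝ :=
  Fin.reverseInduction (motive := fun _ => S → ℝ) (fun _ => 0) fun h β' x =>
    Finset.univ.sup' Finset.univ_nonempty fun a =>
      M.reward h x a + D.bonusOf M h x a β' + ∑ y, D.ref h x a y * β' y

/-- The exploration bonus `CB_h(x,a)`. -/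
def bonus [Fintype A] [Nonempty A] (M : EpisodicMDP S A H) (D : ConfidenceData S A I H)
    (h : Fin H) (x : S) (a : A) : ℝ :=
  D.bonusOf M h x a (D.optimisticValue M h.succ)

/-- `CP_h(x,a) = ∑_y (P̂_h(y|x,a) - P_h(y|x,a)) β^*_{h+1}(y)`. -/
def transitionGap [Fintype A] [Nonempty A] (M : EpisodicMDP S A H) (D : ConfidenceData S A I H)
    (h : Fin H) (x : S) (a : A) : ℝ :=
  ∑ y, (D.ref h x a y - M.trans h x a y) * D.optimisticValue M h.succ y

/-- The policy attains the maximum in the dynamic program at every stage and state. -/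
def IsOptimisticPolicy [Fintype A] [Nonempty A] (M : EpisodicMDP S A H)
    (D : ConfidenceData S A I H) (π : Fin H → S → A) : Prop :=
  ∀ h x, D.optimisticValue M h.castSucc x =
    M.reward h x (π h x) + D.bonus M h x (π h x) +
      ∑ y, D.ref h x (π h x) y * D.optimisticValue M h.succ y

end ConfidenceData

/-- Interaction of a learner with the MDP for `K` episodes. `x t h` is the state at stage `h` of
episode `t`, and `π t` is the policy followed in episode `t`. The σ-algebra `𝓕 (t * (H + 1))` is the
information available before episode `t`, and `𝓕 (t * (H + 1) + h + 1)` the information available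
once `x t h` has been observed; besides the past states it may contain independent randomization of
the learner. -/
structure IsEpisodicInteraction {S A Ω : Type*} [Fintype S] {H K : ℕ} {mΩ : MeasurableSpace Ω}
    (M : EpisodicMDP S A H) (μ : Measure Ω) (𝓕 : Filtration ℕ mΩ)
    (x : Fin K → Fin (H + 1) → Ω → S) (π : Fin K → Ω → Fin H → S → A) : Prop where
  measurable_state : ∀ (t : Fin K) (h : Fin (H + 1)) (y : S),
    MeasurableSet[𝓕 ((t : ℕ) * (H + 1) + (h : ℕ) + 1)] (x t h ⁻¹' {y})
  measurable_policy : ∀ (t : Fin K) (h : Fin H) (y : S) (a : A),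
    MeasurableSet[𝓕 ((t : ℕ) * (H + 1))] {ω | π t ω h y = a}
  initial_law : ∀ (t : Fin K) (y : S),
    μ[(x t 0 ⁻¹' {y}).indicator (fun _ => (1 : ℝ)) | 𝓕 ((t : ℕ) * (H + 1))]
      =ᵐ[μ] fun _ => M.initial y
  transition_law : ∀ (t : Fin K) (h : Fin H) (y : S),
    μ[(x t h.succ ⁻¹' {y}).indicator (fun _ => (1 : ℝ)) | 𝓕 ((t : ℕ) * (H + 1) + (h : ℕ) + 1)]
      =ᵐ[μ] fun ω => M.trans h (x t h.castSucc ω) (π t ω h (x t h.castSucc ω)) y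

/-- The parameters used in episode `t` are determined by the information available before it. -/
structure IsPredictableConfidence {S A I Ω : Type*} {H K : ℕ} {mΩ : MeasurableSpace Ω}
    (𝓕 : Filtration ℕ mΩ) (D : Fin K → Ω → ConfidenceData S A I H) : Prop where
  measurable_ref : ∀ (t : Fin K) (h : Fin H) (x : S) (a : A) (y : S),
    Measurable[𝓕 ((t : ℕ) * (H + 1))] fun ω => (D t ω).ref h x a y
  measurable_weight : ∀ (t : Fin K) (h : Fin H) (i : I) (y : S),
    Measurable[𝓕 ((t : ℕ) * (H + 1))] fun ω => (D t ω).weight h i y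
  measurable_width : ∀ (t : Fin K) (h : Fin H) (i : I) (x : S) (a : A),
    Measurable[𝓕 ((t : ℕ) * (H + 1))] fun ω => (D t ω).width h i x a

/-- The regret `∑_t (V_1^*(x_{1,t}) - V_1^{π_t}(x_{1,t}))`. -/
def regret {S A Ω : Type*} [Fintype S] {H K : ℕ} (M : EpisodicMDP S A H)
    (x : Fin K → Fin (H + 1) → Ω → S) (π : Fin K → Ω → Fin H → S → A) (ω : Ω) : ℝ :=
  ∑ t, (M.optValue (x t 0 ω) - M.value (π t ω) (x t 0 ω))

end

noncomputable section

/-! ### Backward recursion for policy values -/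

/-! Write `β` for the optimistic value. If the true kernel `P` lies in the confidence set, averaging
the dual constraints with weights `P(y|x,a)` is weak duality: `∑ P β' ≤ CB + ∑ P̂ β'`
(`sum_mul_le_bonusOf_add`). Backward induction then gives `V^π ≤ β` for every policy, so the regret
is at most the sum of `β_1 - V_1^{π_t}` at the initial states.

This excess telescopes along the observed trajectory (`optimisticValue_sub_policyValue`). Since
`π_t` attains the maximum defining `β`, each stage contributes `CB + CP` plus the difference between
the conditional mean of the next excess and its realized value. These differences form one
martingale difference sequence of length `K * H`, controlled by Azuma–Hoeffding with probability `1
- δ`. Handling `β - V` as a single process is why one application suffices; the factors 2 in the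
theorem are slack.

Two technical points remain. Azuma needs increments bounded everywhere, so the excess is clamped to
`[0, H]`, which changes nothing when `P` is in the confidence set (`clampedExcess_eq`). The
increments must also be adapted, which requires the value of the linear program to depend measurably
on its data (`measurable_bonusOf`). -/

theorem Fin.sum_filter_zero_eq {S : Type*} [Fintype S] [DecidableEq S] {n : ℕ}
    (f : (Fin (n + 1) → S) → ℝ) (x : S) :
    ∑ τ : Fin (n + 1) → S with τ 0 = x, f τ = ∑ σ : Fin n → S, f (Fin.cons x σ) := by
  rw [Finset.sum_filter, ← (Fin.consEquiv fun _ : Fin (n + 1) => S).sum_comp,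
    Fintype.sum_prod_type, Finset.sum_eq_single x]
  · simp [Fin.consEquiv]
  · intro y _ hy
    simp [Fin.consEquiv, hy]
  · simp

theorem Fin.sum_cons_eq_sum_filter {S : Type*} [Fintype S] [DecidableEq S] {n : ℕ}
    (f : (Fin (n + 1) → S) → ℝ) :
    ∑ τ, f τ = ∑ y, ∑ τ : Fin (n + 1) → S with τ 0 = y, f τ := by
  simp_rw [Fin.sum_filter_zero_eq, ← (Fin.consEquiv fun _ : Fin (n + 1) => S).sum_comp,
    Fintype.sum_prod_type]
  rfl

/-- The trajectory weights of a Markov chain started in `x` sum to one. -/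
theorem sum_trajectory_prod {S : Type*} [Fintype S] [DecidableEq S] {n : ℕ}
    (p : Fin n → S → S → ℝ) (hp : ∀ h x, ∑ y, p h x y = 1) (x : S) :
    ∑ τ : Fin (n + 1) → S with τ 0 = x, ∏ h, p h (τ h.castSucc) (τ h.succ) = 1 := by
  induction n generalizing x with
  | zero => rw [Fin.sum_filter_zero_eq]; simp
  | succ n ih =>
    rw [Fin.sum_filter_zero_eq, Fin.sum_cons_eq_sum_filter]
    -- Condition on the second state `y`: the remaining trajectory is a chain started in `y` with
    -- the kernels shifted by one stage.
    have key : ∀ y, ∑ σ : Fin (n + 1) → S with σ 0 = y,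
        ∏ h, p h ((Fin.cons x σ : Fin (n + 2) → S) h.castSucc)
          ((Fin.cons x σ : Fin (n + 2) → S) h.succ) = p 0 x y := by
      intro y
      rw [← mul_one (p 0 x y), ← ih (fun h => p h.succ) (fun h => hp _) y, Finset.mul_sum]
      refine Finset.sum_congr rfl fun σ hσ => ?_
      rw [Fin.prod_univ_succ]
      simp [(Finset.mem_filter.1 hσ).2]
    simp_rw [key, hp]

/-- A function satisfying the backward recursion is the expected total reward of the chain. -/
theorem sum_trajectory_reward {S : Type*} [Fintype S] [DecidableEq S] {n : ℕ}
    (p : Fin n → S → S → ℝ) (hp : ∀ h x, ∑ y, p h x y = 1) (r : Fin n → S → ℝ)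
    (V : Fin (n + 1) → S → ℝ) (hlast : ∀ x, V (Fin.last n) x = 0)
    (hV : ∀ h x, V h.castSucc x = r h x + ∑ y, p h x y * V h.succ y) (x : S) :
    ∑ τ : Fin (n + 1) → S with τ 0 = x,
      (∏ h, p h (τ h.castSucc) (τ h.succ)) * ∑ h, r h (τ h.castSucc) = V 0 x := by
  induction n generalizing x with
  | zero => simpa [Fin.sum_filter_zero_eq] using (hlast x).symm
  | succ n ih =>
    rw [Fin.sum_filter_zero_eq, Fin.sum_cons_eq_sum_filter]
    -- The first reward is constant over the tail, whose weights sum to one; the later rewards sum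
    -- to `V` at the next stage by induction.
    have key : ∀ y, ∑ σ : Fin (n + 1) → S with σ 0 = y,
        (∏ h, p h ((Fin.cons x σ : Fin (n + 2) → S) h.castSucc)
          ((Fin.cons x σ : Fin (n + 2) → S) h.succ)) *
          ∑ h, r h ((Fin.cons x σ : Fin (n + 2) → S) h.castSucc)
        = p 0 x y * r 0 x + p 0 x y * V (Fin.succ 0) y := by
      intro y
      have h1 := sum_trajectory_prod (fun h => p (Fin.succ h)) (fun h => hp _) y
      have h2 := ih (fun h => p h.succ) (fun h => hp _) (fun h => r h.succ) (fun h => V h.succ)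
        (fun z => by rw [Fin.succ_last]; exact hlast z)
        (fun h z => by rw [Fin.succ_castSucc]; exact hV _ z) y
      rw [← h2, ← mul_one (p 0 x y * r 0 x), ← h1, Finset.mul_sum, Finset.mul_sum,
        ← Finset.sum_add_distrib]
      refine Finset.sum_congr rfl fun σ hσ => ?_
      rw [Fin.prod_univ_succ, Fin.sum_univ_succ]
      simp only [Fin.castSucc_zero, Fin.cons_zero, Fin.cons_succ, (Finset.mem_filter.1 hσ).2,
        ← Fin.succ_castSucc]
      ring
    simp_rw [key]
    rw [Finset.sum_add_distrib, ← Finset.sum_mul, hp, one_mul]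
    exact (hV 0 x).symm

namespace EpisodicMDP

variable {S A : Type*} [Fintype S] {H : ℕ}

/-- The value of a policy from each stage on, by backward recursion. -/
def policyValue (M : EpisodicMDP S A H) (π : Fin H → S → A) : Fin (H + 1) → S → ℝ :=
  Fin.reverseInduction (motive := fun _ => S → ℝ) (fun _ => 0) fun h V x =>
    M.reward h x (π h x) + ∑ y, M.trans h x (π h x) y * V y

theorem policyValue_last (M : EpisodicMDP S A H) (π : Fin H → S → A) (x : S) :
    M.policyValue π (Fin.last H) x = 0 := by
  simp [policyValue]

theorem policyValue_castSucc (M : EpisodicMDP S A H) (π : Fin H → S → A) (h : Fin H) (x : S) :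
    M.policyValue π h.castSucc x =
      M.reward h x (π h x) + ∑ y, M.trans h x (π h x) y * M.policyValue π h.succ y := by
  simp [policyValue]

theorem value_eq_policyValue (M : EpisodicMDP S A H) (π : Fin H → S → A) (x : S) :
    M.value π x = M.policyValue π 0 x := by
  classical
  rw [← sum_trajectory_reward (fun h x y => M.trans h x (π h x) y)
    (fun h x => (M.trans_mem h x _).2) (fun h x => M.reward h x (π h x)) (M.policyValue π)
    (M.policyValue_last π) (M.policyValue_castSucc π) x, value]

theorem policyValue_nonneg (M : EpisodicMDP S A H) (π : Fin H → S → A) (h : Fin (H + 1)) (x : S) :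
    0 ≤ M.policyValue π h x := by
  induction h using Fin.reverseInduction generalizing x with
  | last => rw [policyValue_last]
  | cast h ih =>
    rw [policyValue_castSucc]
    exact add_nonneg (M.reward_mem _ _ _).1
      (Finset.sum_nonneg fun y _ => mul_nonneg ((M.trans_mem _ _ _).1 y) (ih y))

end EpisodicMDP

/-! ### Optimism by weak duality -/

namespace ConfidenceData

variable {S A I : Type*} [Fintype S] [Fintype I] {H : ℕ}

/-- Weak duality at a single pair. Averaging the constraints over `y` with weights `p` leaves the
error term `∑ (p - P̂)(μp - μm)`. Since `|μp - μm| ≤ μp + μm ≤ ∑ w μ`, membership of `p` in the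
confidence set bounds it by `∑ b μ`. No sign of `w` and no normalization of `P̂` enters. -/
theorem le_of_dualConstraint {M : EpisodicMDP S A H} {D : ConfidenceData S A I H}
    {p : Fin H → S → A → S → ℝ} (hp : p ∈ D.confidenceSet) {h : Fin H} {x : S} {a : A} {v : ℝ}
    {β' μp μm : S → ℝ} {μ : I → ℝ} (hd : D.DualConstraint M h x a v β' μp μm μ) :
    M.reward h x a + ∑ y, p h x a y * β' y ≤ v := by
  obtain ⟨hμp, hμm, hμ, hle, hd⟩ := hd
  obtain ⟨hp0, hp1⟩ := hp.1 h x a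
  set c := ∑ z, D.ref h x a z * (μp z - μm z)
  set b := ∑ i, D.width h i x a * μ i with hb
  have avg : ∑ y, p h x a y * M.reward h x a ≤
      ∑ y, p h x a y * (v - β' y - c + (μp y - μm y) - b) :=
    Finset.sum_le_sum fun y _ => mul_le_mul_of_nonneg_left (hd y) (hp0 y)
  rw [← Finset.sum_mul, hp1, one_mul] at avg
  have expand : ∑ y, p h x a y * (v - β' y - c + (μp y - μm y) - b) =
      v - ∑ y, p h x a y * β' y - c + ∑ y, p h x a y * (μp y - μm y) - b := by
    have : ∀ y, p h x a y * (v - β' y - c + (μp y - μm y) - b) =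
        p h x a y * (v - c - b) - p h x a y * β' y + p h x a y * (μp y - μm y) := fun y => by ring
    simp_rw [this]
    rw [Finset.sum_add_distrib, Finset.sum_sub_distrib, ← Finset.sum_mul, hp1]
    ring
  have gap : ∑ y, p h x a y * (μp y - μm y) - c ≤ b := by
    calc ∑ y, p h x a y * (μp y - μm y) - c
        = ∑ y, (p h x a y - D.ref h x a y) * (μp y - μm y) := by
          simp_rw [sub_mul _ _ (μp _ - μm _), Finset.sum_sub_distrib]; rfl
      _ ≤ ∑ y, |p h x a y - D.ref h x a y| * ∑ i, D.weight h i y * μ i := by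
          refine Finset.sum_le_sum fun y _ => ?_
          refine (le_abs_self _).trans ?_
          rw [abs_mul]
          refine mul_le_mul_of_nonneg_left (le_trans ?_ (hle y)) (abs_nonneg _)
          rw [abs_le]
          constructor <;> linarith [hμp y, hμm y]
      _ = ∑ i, (∑ y, D.weight h i y * |p h x a y - D.ref h x a y|) * μ i := by
          simp_rw [Finset.mul_sum, Finset.sum_mul]
          rw [Finset.sum_comm]
          exact Finset.sum_congr rfl fun i _ => Finset.sum_congr rfl fun y _ => by ring
      _ ≤ b := Finset.sum_le_sum fun i _ => mul_le_mul_of_nonneg_right (hp.2 h i x a) (hμ i)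
  linarith

/-- Zero multipliers are always admissible. This makes the set defining the bonus nonempty and also
yields the upper bound on the optimistic value. -/
theorem dualConstraint_zero (M : EpisodicMDP S A H) (D : ConfidenceData S A I H) (h : Fin H)
    (x : S) (a : A) {β' : S → ℝ} {B : ℝ} (hB : ∀ y, β' y ≤ B) :
    D.DualConstraint M h x a (M.reward h x a + B) β' 0 0 0 := by
  refine ⟨by simp, by simp, by simp, by simp, fun y => ?_⟩
  simpa using by linarith [hB y]

theorem sum_mul_le_bonusOf_add {M : EpisodicMDP S A H} {D : ConfidenceData S A I H}
    {p : Fin H → S → A → S → ℝ} (hp : p ∈ D.confidenceSet) (h : Fin H) (x : S) (a : A)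
    (β' : S → ℝ) :
    ∑ y, p h x a y * β' y ≤ D.bonusOf M h x a β' + ∑ y, D.ref h x a y * β' y := by
  rw [← sub_le_iff_le_add]
  refine le_csInf ?_ ?_
  · obtain ⟨B, hB⟩ := (Set.finite_range β').bddAbove
    refine ⟨B - ∑ y, D.ref h x a y * β' y, 0, 0, 0, ?_⟩
    rw [add_assoc, sub_add_cancel]
    exact dualConstraint_zero M D h x a fun y => hB ⟨y, rfl⟩
  · rintro z ⟨μp, μm, μ, hd⟩
    linarith [le_of_dualConstraint hp hd]

theorem bonusOf_add_le {M : EpisodicMDP S A H} {D : ConfidenceData S A I H}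
    {p : Fin H → S → A → S → ℝ} (hp : p ∈ D.confidenceSet) (h : Fin H) (x : S) (a : A)
    {β' : S → ℝ} {B : ℝ} (hB : ∀ y, β' y ≤ B) :
    D.bonusOf M h x a β' + ∑ y, D.ref h x a y * β' y ≤ B := by
  rw [← le_sub_iff_add_le]
  -- Weak duality for `p` supplies the lower bound without which the real infimum would be a default
  -- value.
  refine csInf_le ⟨∑ y, p h x a y * β' y - ∑ y, D.ref h x a y * β' y, ?_⟩ ⟨0, 0, 0, ?_⟩
  · rintro z ⟨μp, μm, μ, hd⟩
    linarith [le_of_dualConstraint hp hd]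
  · rw [add_assoc, sub_add_cancel]
    exact dualConstraint_zero M D h x a hB

variable [Fintype A] [Nonempty A]

theorem optimisticValue_last (M : EpisodicMDP S A H) (D : ConfidenceData S A I H) (x : S) :
    D.optimisticValue M (Fin.last H) x = 0 := by
  simp [optimisticValue]

theorem optimisticValue_castSucc (M : EpisodicMDP S A H) (D : ConfidenceData S A I H) (h : Fin H)
    (x : S) :
    D.optimisticValue M h.castSucc x = Finset.univ.sup' Finset.univ_nonempty fun a =>
      M.reward h x a + D.bonus M h x a + ∑ y, D.ref h x a y * D.optimisticValue M h.succ y := by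
  simp [optimisticValue, bonus]

/-- Optimism: the action chosen by `π` competes in the maximum defining the optimistic value, and
the bonus pays for replacing the true kernel by the reference. -/
theorem policyValue_le_optimisticValue {M : EpisodicMDP S A H} {D : ConfidenceData S A I H}
    (hM : M.trans ∈ D.confidenceSet) (π : Fin H → S → A) (h : Fin (H + 1)) (x : S) :
    M.policyValue π h x ≤ D.optimisticValue M h x := by
  induction h using Fin.reverseInduction generalizing x with
  | last => rw [M.policyValue_last, optimisticValue_last]
  | cast h ih =>
    rw [M.policyValue_castSucc, optimisticValue_castSucc]
    refine le_trans ?_ (Finset.le_sup' _ (Finset.mem_univ (π h x)))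
    rw [add_assoc]
    refine add_le_add_right (le_trans ?_ (sum_mul_le_bonusOf_add hM h x (π h x) _)) _
    exact Finset.sum_le_sum fun y _ => mul_le_mul_of_nonneg_left (ih y) ((M.trans_mem _ _ _).1 y)

/-- From index `h` on, `H - h` rewards of size at most one remain, and bonus plus reference average
never exceeds an upper bound of the next-stage values. -/
theorem optimisticValue_le {M : EpisodicMDP S A H} {D : ConfidenceData S A I H}
    (hM : D.confidenceSet.Nonempty) (h : Fin (H + 1)) (x : S) :
    D.optimisticValue M h x ≤ H - (h : ℕ) := by
  obtain ⟨p, hp⟩ := hM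
  induction h using Fin.reverseInduction generalizing x with
  | last => simp [optimisticValue_last]
  | cast h ih =>
    rw [optimisticValue_castSucc]
    refine Finset.sup'_le _ _ fun a _ => ?_
    have := bonusOf_add_le (M := M) hp h x a ih
    have := (M.reward_mem h x a).2
    simp only [bonus, Fin.val_succ, Nat.cast_add, Nat.cast_one, Fin.val_castSucc] at *
    linarith

/-- The excess of the optimistic value over the value of a policy, clamped to `[0, H]`. -/
def clampedExcess (M : EpisodicMDP S A H) (D : ConfidenceData S A I H) (π : Fin H → S → A)
    (h : Fin (H + 1)) (x : S) : ℝ :=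
  max 0 (min H (D.optimisticValue M h x - M.policyValue π h x))

theorem clampedExcess_nonneg (M : EpisodicMDP S A H) (D : ConfidenceData S A I H)
    (π : Fin H → S → A) (h : Fin (H + 1)) (x : S) : 0 ≤ D.clampedExcess M π h x :=
  le_max_left _ _

theorem clampedExcess_le (M : EpisodicMDP S A H) (D : ConfidenceData S A I H)
    (π : Fin H → S → A) (h : Fin (H + 1)) (x : S) : D.clampedExcess M π h x ≤ H :=
  max_le (Nat.cast_nonneg _) (min_le_left _ _)

/-- The clamp is inactive here: optimism gives the lower end, and `β ≤ H` with `V ≥ 0` the upper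
one. It exists only to bound the noise on outcomes where the confidence set misses the true kernel.
-/
theorem clampedExcess_eq {M : EpisodicMDP S A H} {D : ConfidenceData S A I H}
    (hM : M.trans ∈ D.confidenceSet) (π : Fin H → S → A) (h : Fin (H + 1)) (x : S) :
    D.clampedExcess M π h x = D.optimisticValue M h x - M.policyValue π h x := by
  have h1 := policyValue_le_optimisticValue hM π h x
  have h2 := optimisticValue_le (M := M) ⟨_, hM⟩ h x
  have h3 := M.policyValue_nonneg π h x
  rw [clampedExcess, min_eq_right, max_eq_right] <;> linarith [Nat.cast_nonneg (α := ℝ) (h : ℕ)]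

/-- The deviation of the clamped excess at the next state from its conditional mean. -/
def excessNoise (M : EpisodicMDP S A H) (D : ConfidenceData S A I H) (π : Fin H → S → A)
    (h : Fin H) (x y : S) : ℝ :=
  ∑ z, M.trans h x (π h x) z * D.clampedExcess M π h.succ z - D.clampedExcess M π h.succ y

theorem abs_excessNoise_le (M : EpisodicMDP S A H) (D : ConfidenceData S A I H)
    (π : Fin H → S → A) (h : Fin H) (x y : S) : |D.excessNoise M π h x y| ≤ H := by
  obtain ⟨hp0, hp1⟩ := M.trans_mem h x (π h x)
  have h1 : 0 ≤ ∑ z, M.trans h x (π h x) z * D.clampedExcess M π h.succ z :=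
    Finset.sum_nonneg fun z _ => mul_nonneg (hp0 z) (D.clampedExcess_nonneg M π _ z)
  have h2 : ∑ z, M.trans h x (π h x) z * D.clampedExcess M π h.succ z ≤ H := by
    calc _ ≤ ∑ z, M.trans h x (π h x) z * (H : ℝ) := Finset.sum_le_sum fun z _ =>
          mul_le_mul_of_nonneg_left (D.clampedExcess_le M π _ z) (hp0 z)
      _ = H := by rw [← Finset.sum_mul, hp1, one_mul]
  have h3 := D.clampedExcess_nonneg M π h.succ y
  have h4 := D.clampedExcess_le M π h.succ y
  rw [excessNoise, abs_le]
  constructor <;> linarith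

/-- Decomposition of the excess of the optimistic value along a trajectory. -/
theorem optimisticValue_sub_policyValue {M : EpisodicMDP S A H} {D : ConfidenceData S A I H}
    (hM : M.trans ∈ D.confidenceSet) {π : Fin H → S → A} (hπ : D.IsOptimisticPolicy M π)
    (τ : Fin (H + 1) → S) :
    D.optimisticValue M 0 (τ 0) - M.policyValue π 0 (τ 0) =
      ∑ h : Fin H, D.bonus M h (τ h.castSucc) (π h (τ h.castSucc)) +
      ∑ h : Fin H, D.transitionGap M h (τ h.castSucc) (π h (τ h.castSucc)) +
      ∑ h : Fin H, D.excessNoise M π h (τ h.castSucc) (τ h.succ) := by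
  set Δ : Fin (H + 1) → ℝ := fun h => D.optimisticValue M h (τ h) - M.policyValue π h (τ h)
  -- Rewards cancel in `β - V`; `CP` turns the reference average of `β` into the true average, and
  -- the noise replaces the true average of the next excess by its value at the next state.
  have step : ∀ h : Fin H, D.bonus M h (τ h.castSucc) (π h (τ h.castSucc)) +
      D.transitionGap M h (τ h.castSucc) (π h (τ h.castSucc)) +
      D.excessNoise M π h (τ h.castSucc) (τ h.succ) = Δ h.castSucc - Δ h.succ := by
    intro h
    simp only [Δ, hπ h (τ h.castSucc), M.policyValue_castSucc, transitionGap, excessNoise,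
      clampedExcess_eq hM, mul_sub, sub_mul, Finset.sum_sub_distrib]
    ring
  rw [← Finset.sum_add_distrib, ← Finset.sum_add_distrib, Finset.sum_congr rfl fun h _ => step h,
    Finset.sum_sub_distrib]
  have hlast : Δ (Fin.last H) = 0 := by
    simp [Δ, optimisticValue_last, M.policyValue_last]
  have h1 := Fin.sum_univ_castSucc Δ
  have h2 := Fin.sum_univ_succ Δ
  change Δ 0 = _
  linarith

end ConfidenceData

/-! ### Measurability of the optimistic values -/

/-- The projection of a closed set along a σ-compact space is an `F_σ` set, hence measurable. -/
theorem IsClosed.measurableSet_image_fst {X Y : Type*} [TopologicalSpace X] [MeasurableSpace X]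
    [OpensMeasurableSpace X] [TopologicalSpace Y] [SigmaCompactSpace Y] {C : Set (X × Y)}
    (hC : IsClosed C) : MeasurableSet (Prod.fst '' C) := by
  have hunion : Prod.fst '' C =
      ⋃ n, Prod.fst '' {q : X × compactCovering Y n | (q.1, (q.2 : Y)) ∈ C} := by
    ext θ
    simp only [Set.mem_image, Set.mem_iUnion, Prod.exists, Set.mem_ofPred_eq]
    constructor
    · rintro ⟨θ', y, h, rfl⟩
      obtain ⟨n, hn⟩ := exists_mem_compactCovering y
      exact ⟨n, θ', ⟨y, hn⟩, h, rfl⟩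
    · rintro ⟨n, θ', y, h, rfl⟩
      exact ⟨θ', y, h, rfl⟩
  rw [hunion]
  -- Over each compact piece of `Y` the projection is a closed map.
  refine MeasurableSet.iUnion fun n => IsClosed.measurableSet ?_
  have : CompactSpace (compactCovering Y n) :=
    isCompact_iff_compactSpace.1 (isCompact_compactCovering Y n)
  exact isClosedMap_fst_of_compactSpace _ (hC.preimage (by fun_prop))

/-- The value of a parametric minimization problem with closed constraints is measurable. -/
theorem IsClosed.measurable_sInf_fiber {X Y : Type*} [TopologicalSpace X] [MeasurableSpace X]
    [OpensMeasurableSpace X] [TopologicalSpace Y] [SigmaCompactSpace Y] {C : Set (X × (Y × ℝ))}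
    (hC : IsClosed C) : Measurable fun θ => sInf {z : ℝ | ∃ y, (θ, (y, z)) ∈ C} := by
  set F : X → Set ℝ := fun θ => {z | ∃ y, (θ, (y, z)) ∈ C} with hF
  have hL : ∀ c : ℝ, MeasurableSet {θ | ∃ z ∈ F θ, z ≤ c} := by
    intro c
    have hclosed : IsClosed (C ∩ {q | q.2.2 ≤ c}) :=
      hC.inter (_root_.isClosed_le (by fun_prop) continuous_const)
    convert hclosed.measurableSet_image_fst using 1
    ext θ
    simp only [hF, Set.mem_ofPred_eq, Set.mem_image, Set.mem_inter_iff, Prod.exists]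
    constructor
    · rintro ⟨z, ⟨y, hy⟩, hz⟩
      exact ⟨θ, y, z, ⟨hy, hz⟩, rfl⟩
    · rintro ⟨θ, y, z, ⟨hy, hz⟩, rfl⟩
      exact ⟨z, ⟨y, hy⟩, hz⟩
  have hlt : ∀ c : ℝ, MeasurableSet {θ | ∃ z ∈ F θ, z < c} := by
    intro c
    have : {θ | ∃ z ∈ F θ, z < c} = ⋃ q : {q : ℚ // (q : ℝ) < c}, {θ | ∃ z ∈ F θ, z ≤ q} := by
      ext θ
      simp only [Set.mem_ofPred_eq, Set.mem_iUnion]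
      constructor
      · rintro ⟨z, hz, hzc⟩
        obtain ⟨q, hzq, hqc⟩ := exists_rat_btwn hzc
        exact ⟨⟨q, hqc⟩, z, hz, hzq.le⟩
      · rintro ⟨q, z, hz, hzq⟩
        exact ⟨z, hz, hzq.trans_lt q.2⟩
    rw [this]
    exact MeasurableSet.iUnion fun q => hL q
  have hne : MeasurableSet {θ | (F θ).Nonempty} := by
    have : {θ | (F θ).Nonempty} = ⋃ n : ℕ, {θ | ∃ z ∈ F θ, z ≤ n} := by
      ext θ
      simp only [Set.mem_ofPred_eq, Set.mem_iUnion]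
      constructor
      · rintro ⟨z, hz⟩
        obtain ⟨n, hn⟩ := exists_nat_ge z
        exact ⟨n, z, hz, hn⟩
      · rintro ⟨n, z, hz, -⟩
        exact ⟨z, hz⟩
    rw [this]
    exact MeasurableSet.iUnion fun n => hL n
  have hbdd : MeasurableSet {θ | BddBelow (F θ)} := by
    have : {θ | BddBelow (F θ)} = ⋃ n : ℕ, {θ | ∃ z ∈ F θ, z < -n}ᶜ := by
      ext θ
      simp only [Set.mem_ofPred_eq, Set.mem_iUnion, Set.mem_compl_iff, not_exists, not_and, not_lt]
      constructor
      · rintro ⟨b, hb⟩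
        obtain ⟨n, hn⟩ := exists_nat_ge (-b)
        exact ⟨n, fun z hz => by linarith [hb hz]⟩
      · rintro ⟨n, hn⟩
        exact ⟨-n, fun z hz => hn z hz⟩
    rw [this]
    exact MeasurableSet.iUnion fun n => (hlt _).compl
  refine measurable_of_Iio fun c => ?_
  -- Where the fiber is empty or unbounded below, the real `sInf` is `0`, which accounts for the
  -- second part of the union.
  have hset : (fun θ => sInf (F θ)) ⁻¹' Set.Iio c =
      ({θ | (F θ).Nonempty} ∩ {θ | BddBelow (F θ)} ∩ {θ | ∃ z ∈ F θ, z < c}) ∪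
        (({θ | (F θ).Nonempty} ∩ {θ | BddBelow (F θ)})ᶜ ∩ {_θ | 0 < c}) := by
    ext θ
    by_cases h : (F θ).Nonempty ∧ BddBelow (F θ)
    · simp [h.1, h.2, csInf_lt_iff h.2 h.1]
    · have h0 : sInf (F θ) = 0 := by
        rcases not_and_or.1 h with h | h
        · rw [Set.not_nonempty_iff_eq_empty.1 h, Real.sInf_empty]
        · exact Real.sInf_of_not_bddBelow h
      rw [Set.mem_preimage, Set.mem_Iio, h0]
      change 0 < c ↔ (((F θ).Nonempty ∧ BddBelow (F θ)) ∧ _) ∨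
        (¬ ((F θ).Nonempty ∧ BddBelow (F θ)) ∧ 0 < c)
      tauto
  rw [hset]
  exact ((hne.inter hbdd).inter (hlt c)).union ((hne.inter hbdd).compl.inter (.const _))

namespace ConfidenceData

variable {S A I Ω : Type*} [Fintype S] [Fintype I] {H : ℕ}

theorem measurable_bonusOf {_ : MeasurableSpace Ω} (M : EpisodicMDP S A H)
    {D : Ω → ConfidenceData S A I H} {h : Fin H} {x : S} {a : A} {β' : Ω → S → ℝ}
    (href : ∀ y, Measurable fun ω => (D ω).ref h x a y)
    (hweight : ∀ i y, Measurable fun ω => (D ω).weight h i y)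
    (hwidth : ∀ i, Measurable fun ω => (D ω).width h i x a)
    (hβ : ∀ y, Measurable fun ω => β' ω y) :
    Measurable fun ω => (D ω).bonusOf M h x a (β' ω) := by
  -- Parameters `(P̂, w, b, β')` are paired with unknowns `((μp, μm, μ), z)`. The constraints are
  -- non-strict polynomial inequalities in all of them jointly, so `C` is closed.
  let C : Set (((S → ℝ) × (I → S → ℝ) × (I → ℝ) × (S → ℝ)) ×
      (((S → ℝ) × (S → ℝ) × (I → ℝ)) × ℝ)) :=
    {q | (∀ y, 0 ≤ q.2.1.1 y) ∧ (∀ y, 0 ≤ q.2.1.2.1 y) ∧ (∀ i, 0 ≤ q.2.1.2.2 i) ∧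
      (∀ y, q.2.1.1 y + q.2.1.2.1 y ≤ ∑ i, q.1.2.1 i y * q.2.1.2.2 i) ∧
      ∀ y, M.reward h x a ≤ (M.reward h x a + q.2.2 + ∑ z, q.1.1 z * q.1.2.2.2 z) - q.1.2.2.2 y
        - ∑ z, q.1.1 z * (q.2.1.1 z - q.2.1.2.1 z) + (q.2.1.1 y - q.2.1.2.1 y)
        - ∑ i, q.1.2.2.1 i * q.2.1.2.2 i}
  have hC : IsClosed C := by
    simp only [C, Set.ofPred_and, Set.ofPred_forall]
    refine .inter (isClosed_iInter fun y => isClosed_le (by fun_prop) (by fun_prop)) <|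
      .inter (isClosed_iInter fun y => isClosed_le (by fun_prop) (by fun_prop)) <|
      .inter (isClosed_iInter fun i => isClosed_le (by fun_prop) (by fun_prop)) <|
      .inter (isClosed_iInter fun y => isClosed_le (by fun_prop) (by fun_prop)) <|
      isClosed_iInter fun y => isClosed_le (by fun_prop) (by fun_prop)
  have hparam : Measurable fun ω => ((D ω).ref h x a, (D ω).weight h,
      (fun i => (D ω).width h i x a), β' ω) :=
    (measurable_pi_lambda _ href).prodMk <|
      (measurable_pi_lambda _ fun i => measurable_pi_lambda _ (hweight i)).prodMk <|
      (measurable_pi_lambda _ hwidth).prodMk (measurable_pi_lambda _ hβ)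
  convert hC.measurable_sInf_fiber.comp hparam using 2 with ω
  simp only [bonusOf, DualConstraint, Function.comp, C, Set.mem_ofPred_eq, Prod.exists]

theorem measurable_optimisticValue [Fintype A] [Nonempty A] {_ : MeasurableSpace Ω}
    (M : EpisodicMDP S A H) {D : Ω → ConfidenceData S A I H}
    (href : ∀ h x a y, Measurable fun ω => (D ω).ref h x a y)
    (hweight : ∀ h i y, Measurable fun ω => (D ω).weight h i y)
    (hwidth : ∀ h i x a, Measurable fun ω => (D ω).width h i x a) (h : Fin (H + 1)) (x : S) :
    Measurable fun ω => (D ω).optimisticValue M h x := by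
  induction h using Fin.reverseInduction generalizing x with
  | last => simp only [optimisticValue_last, measurable_const]
  | cast h ih =>
    simp only [optimisticValue_castSucc]
    have := Finset.measurable_sup' (Finset.univ_nonempty (α := A)) (f := fun a ω =>
      M.reward h x a + (D ω).bonus M h x a +
        ∑ y, (D ω).ref h x a y * (D ω).optimisticValue M h.succ y) fun a _ =>
      (measurable_const.add (measurable_bonusOf M (href h x a) (hweight h)
        (fun i => hwidth h i x a) ih)).add
        (Finset.measurable_sum _ fun y _ => (href h x a y).mul (ih y))
    convert this using 2 with ω
    rw [Finset.sup'_apply]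

end ConfidenceData

/-! ### The Azuma–Hoeffding inequality -/

/-- By convexity, the exponential lies below its chord between the endpoints `±c`. -/
theorem Real.exp_mul_le_cosh_add_sinh {c y : ℝ} (hc : 0 < c) (hy : |y| ≤ c) (l : ℝ) :
    Real.exp (l * y) ≤ Real.cosh (l * c) + y / c * Real.sinh (l * c) := by
  obtain ⟨h1, h2⟩ := abs_le.1 hy
  have hlow : -1 ≤ y / c := by rw [le_div_iff₀ hc]; linarith
  have hupp : y / c ≤ 1 := by rw [div_le_iff₀ hc]; linarith
  have hconv := convexOn_exp.2 (Set.mem_univ (l * c)) (Set.mem_univ (-(l * c)))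
    (show 0 ≤ (1 + y / c) / 2 by linarith) (show 0 ≤ (1 - y / c) / 2 by linarith) (by ring)
  have harg : (1 + y / c) / 2 * (l * c) + (1 - y / c) / 2 * -(l * c) = l * y := by
    field_simp; ring
  simp only [smul_eq_mul, harg] at hconv
  rw [Real.cosh_eq, Real.sinh_eq]
  linarith

namespace MeasureTheory

variable {Ω : Type*} {mΩ : MeasurableSpace Ω} {μ : Measure Ω}

theorem integrable_of_forall_abs_le [IsFiniteMeasure μ] {f : Ω → ℝ} (hf : Measurable f) {B : ℝ}
    (hB : ∀ ω, |f ω| ≤ B) : Integrable f μ :=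
  Integrable.of_bound hf.aestronglyMeasurable B (.of_forall hB)

theorem integral_mul_eq_zero_of_condExp_eq_zero [IsFiniteMeasure μ] {m : MeasurableSpace Ω}
    (hm : m ≤ mΩ) {Z ξ : Ω → ℝ} (hZ : Measurable[m] Z) (hξ : Integrable ξ μ) {B : ℝ}
    (hB : ∀ ω, |Z ω| ≤ B) (hcond : μ[ξ | m] =ᵐ[μ] 0) : ∫ ω, Z ω * ξ ω ∂μ = 0 := by
  have h := condExp_stronglyMeasurable_mul_of_bound hm (μ := μ) hZ.stronglyMeasurable hξ B
    (.of_forall hB)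
  calc ∫ ω, Z ω * ξ ω ∂μ = ∫ ω, (μ[Z * ξ | m]) ω ∂μ := (integral_condExp hm).symm
    _ = ∫ _ω, (0 : ℝ) ∂μ := by
        refine integral_congr_ae ?_
        filter_upwards [h, hcond] with ω h1 h2
        simp [h1, h2]
    _ = 0 := integral_zero _ _

/-- One step of Azuma, with the past as a bounded weight `Z`. In the chord bound the term linear in
`ξ` integrates to zero against `Z`, and `cosh u ≤ exp (u ^ 2 / 2)` bounds the rest. -/
theorem integral_mul_exp_le [IsFiniteMeasure μ] {m : MeasurableSpace Ω} (hm : m ≤ mΩ)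
    {Z ξ : Ω → ℝ} (hZ : Measurable[m] Z) (hZ0 : ∀ ω, 0 ≤ Z ω) {B : ℝ} (hB : ∀ ω, Z ω ≤ B)
    (hξ : Measurable[mΩ] ξ) {c : ℝ} (hc : 0 < c) (hξc : ∀ ω, |ξ ω| ≤ c)
    (hcond : μ[ξ | m] =ᵐ[μ] 0) (l : ℝ) :
    ∫ ω, Z ω * Real.exp (l * ξ ω) ∂μ ≤ Real.exp (l ^ 2 * c ^ 2 / 2) * ∫ ω, Z ω ∂μ := by
  have hZabs : ∀ ω, |Z ω| ≤ B := fun ω => by rw [abs_of_nonneg (hZ0 ω)]; exact hB ω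
  have hZi : Integrable Z μ := integrable_of_forall_abs_le (hZ.mono hm le_rfl) hZabs
  have hξi : Integrable ξ μ := integrable_of_forall_abs_le hξ hξc
  have hZξ : Integrable (fun ω => Z ω * ξ ω) μ :=
    hξi.bdd_mul (hZ.mono hm le_rfl).aestronglyMeasurable (.of_forall hZabs)
  have hle : ∀ ω, Z ω * Real.exp (l * ξ ω) ≤
      Real.cosh (l * c) * Z ω + Real.sinh (l * c) / c * (Z ω * ξ ω) := fun ω =>
    calc Z ω * Real.exp (l * ξ ω)
        ≤ Z ω * (Real.cosh (l * c) + ξ ω / c * Real.sinh (l * c)) :=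
          mul_le_mul_of_nonneg_left (Real.exp_mul_le_cosh_add_sinh hc (hξc ω) l) (hZ0 ω)
      _ = _ := by ring
  calc ∫ ω, Z ω * Real.exp (l * ξ ω) ∂μ
      ≤ ∫ ω, (Real.cosh (l * c) * Z ω + Real.sinh (l * c) / c * (Z ω * ξ ω)) ∂μ :=
        integral_mono_of_nonneg (.of_forall fun ω => mul_nonneg (hZ0 ω) (Real.exp_nonneg _))
          ((hZi.const_mul _).add (hZξ.const_mul _)) (.of_forall hle)
    _ = Real.cosh (l * c) * ∫ ω, Z ω ∂μ := by
        rw [integral_add (hZi.const_mul _) (hZξ.const_mul _), integral_const_mul,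
          integral_const_mul, integral_mul_eq_zero_of_condExp_eq_zero hm hZ hξi hZabs hcond,
          mul_zero, add_zero]
    _ ≤ _ := by
        rw [← mul_pow]
        exact mul_le_mul_of_nonneg_right (Real.cosh_le_exp_half_sq _) (integral_nonneg hZ0)

variable [IsProbabilityMeasure μ] {m : ℕ → MeasurableSpace Ω} {c : ℝ}

theorem integral_exp_sum_le (hmono : Monotone m) (hm : ∀ n, m n ≤ mΩ) (hc : 0 < c) {N : ℕ}
    {ξ : Fin N → Ω → ℝ} (hξ : ∀ n : Fin N, Measurable[m (n + 1)] (ξ n)) (hξc : ∀ n ω, |ξ n ω| ≤ c)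
    (hcond : ∀ n : Fin N, μ[ξ n | m n] =ᵐ[μ] 0) (l : ℝ) :
    ∫ ω, Real.exp (l * ∑ n, ξ n ω) ∂μ ≤ Real.exp (N * (l ^ 2 * c ^ 2 / 2)) := by
  induction N with
  | zero => simp
  | succ N ih =>
    have hZ : Measurable[m N] fun ω => Real.exp (l * ∑ n : Fin N, ξ n.castSucc ω) :=
      Real.measurable_exp.comp <| Measurable.const_mul (Finset.measurable_sum _ fun n _ =>
        (hξ n.castSucc).mono (hmono (by simp)) le_rfl) l
    have hB : ∀ ω, Real.exp (l * ∑ n : Fin N, ξ n.castSucc ω) ≤ Real.exp (|l| * (N * c)) := by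
      intro ω
      refine Real.exp_le_exp.2 ((le_abs_self _).trans ?_)
      rw [abs_mul]
      refine mul_le_mul_of_nonneg_left ((Finset.abs_sum_le_sum_abs _ _).trans ?_) (abs_nonneg _)
      exact (Finset.sum_le_sum fun n _ => hξc n.castSucc ω).trans (by simp)
    have step := integral_mul_exp_le (hm N) hZ (fun _ => Real.exp_nonneg _) hB
      ((hξ (Fin.last N)).mono (hm _) le_rfl) hc (hξc (Fin.last N))
      (by simpa using hcond (Fin.last N)) l
    simp_rw [Fin.sum_univ_castSucc, mul_add, Real.exp_add]
    refine step.trans ?_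
    push_cast
    rw [add_mul, one_mul, Real.exp_add, mul_comm]
    exact mul_le_mul_of_nonneg_right (ih (fun n => hξ n.castSucc) (fun n => hξc n.castSucc)
      fun n => hcond n.castSucc) (Real.exp_nonneg _)

/-- **Azuma–Hoeffding inequality** for bounded martingale differences. -/
theorem measureReal_le_sum_le (hmono : Monotone m) (hm : ∀ n, m n ≤ mΩ) (hc : 0 < c) {N : ℕ}
    (hN : 0 < N) {ξ : Fin N → Ω → ℝ} (hξ : ∀ n : Fin N, Measurable[m (n + 1)] (ξ n))
    (hξc : ∀ n ω, |ξ n ω| ≤ c) (hcond : ∀ n : Fin N, μ[ξ n | m n] =ᵐ[μ] 0) {δ : ℝ} (hδ : 0 < δ)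
    (hδ1 : δ ≤ 1) :
    μ.real {ω | c * Real.sqrt (2 * N * Real.log (1 / δ)) ≤ ∑ n, ξ n ω} ≤ δ := by
  set s := Real.sqrt (2 * N * Real.log (1 / δ)) with hs
  have hN' : (0 : ℝ) < N := Nat.cast_pos.2 hN
  have hlog : 0 ≤ Real.log (1 / δ) := Real.log_nonneg (by rw [le_div_iff₀ hδ]; linarith)
  have hs2 : s ^ 2 = 2 * N * Real.log (1 / δ) := Real.sq_sqrt (by positivity)
  -- The minimizer of the Chernoff exponent `-l c s + N l² c² / 2`; the minimum is `-s² / (2N) =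
  -- -log (1/δ)`.
  set l := s / (N * c) with hl
  have hsum : Measurable fun ω => ∑ n, ξ n ω :=
    Finset.measurable_sum _ fun n _ => (hξ n).mono (hm _) le_rfl
  have hint : Integrable (fun ω => Real.exp (l * ∑ n, ξ n ω)) μ := by
    refine integrable_of_forall_abs_le (B := Real.exp (|l| * (N * c)))
      (Real.measurable_exp.comp (hsum.const_mul l)) fun ω => ?_
    rw [Real.abs_exp]
    refine Real.exp_le_exp.2 ((le_abs_self _).trans ?_)
    rw [abs_mul]
    refine mul_le_mul_of_nonneg_left ((Finset.abs_sum_le_sum_abs _ _).trans ?_) (abs_nonneg _)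
    exact (Finset.sum_le_sum fun n _ => hξc n ω).trans (by simp)
  have hchernoff := ProbabilityTheory.measure_ge_le_exp_mul_mgf (μ := μ)
    (X := fun ω => ∑ n, ξ n ω) (t := l) (c * s) (by positivity) hint
  refine hchernoff.trans ((mul_le_mul_of_nonneg_left
    (integral_exp_sum_le hmono hm hc hξ hξc hcond l) (Real.exp_nonneg _)).trans ?_)
  rw [← Real.exp_add]
  have hexp : -l * (c * s) + N * (l ^ 2 * c ^ 2 / 2) = -Real.log (1 / δ) := by
    have : -l * (c * s) + N * (l ^ 2 * c ^ 2 / 2) = -(s ^ 2 / (2 * N)) := by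
      rw [hl]; field_simp; ring
    rw [this, hs2]; field_simp
  rw [hexp, one_div, Real.log_inv, neg_neg, Real.exp_log hδ]

end MeasureTheory

/-! ### The martingale differences of an episodic interaction -/

/-- Splitting by the finitely many values of `g` allows a random state or policy to be substituted
into a measurable family. -/
theorem Measurable.apply_of_finite {Ω β : Type*} [Finite β] {_ : MeasurableSpace Ω} {g : Ω → β}
    (hg : ∀ b, MeasurableSet {ω | g ω = b}) {f : β → Ω → ℝ} (hf : ∀ b, Measurable (f b)) :
    Measurable fun ω => f (g ω) ω := by
  classical
  have := Fintype.ofFinite β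
  have heq : (fun ω => f (g ω) ω) = fun ω => ∑ b, {ω | g ω = b}.indicator (f b) ω := by
    ext ω
    rw [Finset.sum_eq_single (g ω)]
    · simp
    · intro b _ hb
      exact Set.indicator_of_notMem (fun h => hb h.symm) _
    · simp
  rw [heq]
  exact Finset.measurable_sum _ fun b _ => (hf b).indicator (hg b)

namespace IsEpisodicInteraction

variable {S A I Ω : Type*} [Fintype S] {H K : ℕ}
  {mΩ : MeasurableSpace Ω} {M : EpisodicMDP S A H} {μ : Measure Ω} {𝓕 : Filtration ℕ mΩ}
  {x : Fin K → Fin (H + 1) → Ω → S} {π : Fin K → Ω → Fin H → S → A}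
  {D : Fin K → Ω → ConfidenceData S A I H}

theorem measurableSet_policy_eq (hrun : IsEpisodicInteraction M μ 𝓕 x π) (t : Fin K)
    (p : Fin H → S → A) : MeasurableSet[𝓕 (t * (H + 1))] {ω | π t ω = p} := by
  have : {ω | π t ω = p} = ⋂ h, ⋂ y, {ω | π t ω h y = p h y} := by
    ext ω
    simp [funext_iff]
  rw [this]
  exact MeasurableSet.iInter fun h => MeasurableSet.iInter fun y =>
    hrun.measurable_policy t h y (p h y)

theorem measurable_trans [Finite A] (hrun : IsEpisodicInteraction M μ 𝓕 x π) (t : Fin K) (h : Fin H)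
    (y : S) : Measurable[𝓕 (t * (H + 1) + h + 1)] fun ω =>
      M.trans h (x t h.castSucc ω) (π t ω h (x t h.castSucc ω)) y := by
  refine Measurable.apply_of_finite (g := fun ω => x t h.castSucc ω)
    (f := fun s ω => M.trans h s (π t ω h s) y) (hrun.measurable_state t h.castSucc) fun s => ?_
  exact Measurable.apply_of_finite
    (fun p => 𝓕.mono (by omega) _ (hrun.measurableSet_policy_eq t p))
    (f := fun p _ => M.trans h s (p h s) y) fun p => measurable_const

variable [Fintype A] [Nonempty A] [Fintype I]

theorem measurable_clampedExcess (hrun : IsEpisodicInteraction M μ 𝓕 x π)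
    (hD : IsPredictableConfidence 𝓕 D) (t : Fin K) (h : Fin (H + 1)) (y : S) :
    Measurable[𝓕 (t * (H + 1))] fun ω => (D t ω).clampedExcess M (π t ω) h y := by
  refine Measurable.apply_of_finite (hrun.measurableSet_policy_eq t)
    (f := fun p ω => (D t ω).clampedExcess M p h y) fun p => ?_
  exact measurable_const.max (measurable_const.min
    ((ConfidenceData.measurable_optimisticValue M (hD.measurable_ref t)
      (hD.measurable_weight t) (hD.measurable_width t) h y).sub measurable_const))

theorem measurable_excessNoise (hrun : IsEpisodicInteraction M μ 𝓕 x π)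
    (hD : IsPredictableConfidence 𝓕 D) (t : Fin K) (h : Fin H) :
    Measurable[𝓕 (t * (H + 1) + h + 2)] fun ω =>
      (D t ω).excessNoise M (π t ω) h (x t h.castSucc ω) (x t h.succ ω) := by
  have hΔ : ∀ y, Measurable[𝓕 (t * (H + 1) + h + 2)] fun ω =>
      (D t ω).clampedExcess M (π t ω) h.succ y := fun y =>
    (hrun.measurable_clampedExcess hD t h.succ y).mono (𝓕.mono (by omega)) le_rfl
  refine Measurable.sub (Finset.measurable_sum _ fun y _ =>
    ((hrun.measurable_trans t h y).mono (𝓕.mono (by omega)) le_rfl).mul (hΔ y)) ?_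
  exact Measurable.apply_of_finite (g := fun ω => x t h.succ ω)
    (f := fun s ω => (D t ω).clampedExcess M (π t ω) h.succ s)
    (hrun.measurable_state t h.succ) hΔ

theorem condExp_excessNoise [IsProbabilityMeasure μ] (hrun : IsEpisodicInteraction M μ 𝓕 x π)
    (hD : IsPredictableConfidence 𝓕 D) (t : Fin K) (h : Fin H) :
    μ[fun ω => (D t ω).excessNoise M (π t ω) h (x t h.castSucc ω) (x t h.succ ω) |
      𝓕 (t * (H + 1) + h + 1)] =ᵐ[μ] 0 := by
  classical
  set m := 𝓕 (t * (H + 1) + h + 1)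
  have hm : m ≤ mΩ := 𝓕.le _
  set Δ : S → Ω → ℝ := fun y ω => (D t ω).clampedExcess M (π t ω) h.succ y
  set P : S → Ω → ℝ := fun y ω => M.trans h (x t h.castSucc ω) (π t ω h (x t h.castSucc ω)) y
  set J : S → Ω → ℝ := fun y => (x t h.succ ⁻¹' {y}).indicator fun _ => (1 : ℝ)
  have hΔ : ∀ y, StronglyMeasurable[m] (Δ y) := fun y =>
    ((hrun.measurable_clampedExcess hD t h.succ y).mono (𝓕.mono (by omega))
      le_rfl).stronglyMeasurable
  have hΔb : ∀ y ω, ‖Δ y ω‖ ≤ H := fun y ω => by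
    rw [Real.norm_of_nonneg (ConfidenceData.clampedExcess_nonneg ..)]
    exact ConfidenceData.clampedExcess_le ..
  have hP : ∀ y, StronglyMeasurable[m] (P y) := fun y =>
    (hrun.measurable_trans t h y).stronglyMeasurable
  have hPi : ∀ y, Integrable (P y) μ := fun y => by
    refine Integrable.of_bound ((hP y).mono hm).aestronglyMeasurable 1 (.of_forall fun ω => ?_)
    have hmem := M.trans_mem h (x t h.castSucc ω) (π t ω h (x t h.castSucc ω))
    rw [Real.norm_of_nonneg (hmem.1 y), ← hmem.2]
    exact Finset.single_le_sum (fun z _ => hmem.1 z) (Finset.mem_univ y)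
  have hJi : ∀ y, Integrable (J y) μ := fun y =>
    (integrable_const (1 : ℝ)).indicator (𝓕.le _ _ (hrun.measurable_state t h.succ y))
  -- `Δ y` and `P y` are known at stage `h`, and only the indicator `J y` of the next state is new.
  -- Its conditional mean is `P y`, so each summand has conditional mean zero.
  have hdecomp : (fun ω => (D t ω).excessNoise M (π t ω) h (x t h.castSucc ω) (x t h.succ ω)) =
      ∑ y, Δ y * (P y - J y) := by
    ext ω
    have hJ : ∑ y, Δ y ω * J y ω = Δ (x t h.succ ω) ω := by
      rw [Finset.sum_eq_single (x t h.succ ω)]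
      · simp [J]
      · intro y _ hy
        simp [J, Ne.symm hy]
      · simp
    simp only [Finset.sum_apply, Pi.mul_apply, Pi.sub_apply, mul_sub, Finset.sum_sub_distrib, hJ,
      mul_comm (Δ _ ω) (P _ ω)]
    rfl
  have hterm : ∀ y, μ[Δ y * (P y - J y) | m] =ᵐ[μ] 0 := fun y => by
    have hpull := condExp_stronglyMeasurable_mul_of_bound hm (hΔ y) ((hPi y).sub (hJi y)) H
      (.of_forall (hΔb y))
    have hlaw : μ[J y | m] =ᵐ[μ] P y := hrun.transition_law t h y
    filter_upwards [hpull, condExp_sub (hPi y) (hJi y) m, hlaw] with ω h1 h2 h3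
    rw [h1, Pi.mul_apply, h2, Pi.sub_apply, h3, condExp_of_stronglyMeasurable hm (hP y) (hPi y)]
    simp
  rw [hdecomp]
  have hsum := condExp_finsetSum (μ := μ) (s := Finset.univ) (f := fun y => Δ y * (P y - J y))
    (fun y _ => ((hPi y).sub (hJi y)).bdd_mul ((hΔ y).mono hm).aestronglyMeasurable
      (.of_forall (hΔb y))) m
  refine hsum.trans ?_
  filter_upwards [(Finset.eventually_all Finset.univ).2 fun y _ => hterm y] with ω hω
  simp only [Finset.sum_apply]
  exact Finset.sum_eq_zero fun y _ => hω y (Finset.mem_univ y)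

/-- With probability at least `1 - δ` the accumulated noise is at most `H √(2 K H log (1/δ))`. -/
theorem exists_sum_excessNoise_le [IsProbabilityMeasure μ]
    (hrun : IsEpisodicInteraction M μ 𝓕 x π) (hD : IsPredictableConfidence 𝓕 D) {δ : ℝ}
    (hδ : 0 < δ) (hδ1 : δ ≤ 1) :
    ∃ G : Set Ω, MeasurableSet G ∧ 1 - δ ≤ μ.real G ∧ ∀ ω ∈ G,
      ∑ t, ∑ h : Fin H, (D t ω).excessNoise M (π t ω) h (x t h.castSucc ω) (x t h.succ ω) ≤
        H * Real.sqrt (2 * (K * H : ℕ) * Real.log (1 / δ)) := by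
  let ξ : Fin (K * H) → Ω → ℝ := fun n ω =>
    (D n.divNat ω).excessNoise M (π n.divNat ω) n.modNat (x n.divNat n.modNat.castSucc ω)
      (x n.divNat n.modNat.succ ω)
  have hreindex : ∀ ω, ∑ t, ∑ h : Fin H,
      (D t ω).excessNoise M (π t ω) h (x t h.castSucc ω) (x t h.succ ω) = ∑ n, ξ n ω := by
    intro ω
    rw [← Fintype.sum_prod_type', ← finProdFinEquiv.symm.sum_comp]
    rfl
  simp only [hreindex]
  rcases Nat.eq_zero_or_pos (K * H) with h0 | hpos
  · refine ⟨Set.univ, .univ, by simp [hδ.le], fun ω _ => ?_⟩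
    have : IsEmpty (Fin (K * H)) := by rw [h0]; infer_instance
    simp only [Finset.univ_eq_empty, Finset.sum_empty]
    positivity
  have hH : 0 < H := Nat.pos_of_mul_pos_left hpos
  have hindex : ∀ n : Fin (K * H),
      (n.divNat : ℕ) * (H + 1) + (n.modNat : ℕ) + 1 = n + n / H + 1 := by
    intro n
    have := Nat.div_add_mod (n : ℕ) H
    simp only [Fin.coe_divNat, Fin.coe_modNat]
    rw [mul_add, mul_one, mul_comm (n / H : ℕ) H]
    omega
  -- Each episode has `H` transitions but takes `H + 1` steps of `𝓕`, so the `n`-th increment is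
  -- shifted by its episode number `n / H`. Crossing an episode boundary skips one index, the
  -- observation of the new initial state.
  let m : ℕ → MeasurableSpace Ω := fun n => 𝓕 (n + n / H + 1)
  have hmono : Monotone m := fun a b hab =>
    𝓕.mono (by have := Nat.div_le_div_right (c := H) hab; omega)
  have hmeas : ∀ n : Fin (K * H), Measurable[m (n + 1)] (ξ n) := fun n =>
    (hrun.measurable_excessNoise hD n.divNat n.modNat).mono (𝓕.mono (by
      have := hindex n
      have := Nat.div_le_div_right (c := H) (Nat.le_succ n)
      simp only [Nat.succ_eq_add_one] at this
      omega)) le_rfl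
  have hcond : ∀ n : Fin (K * H), μ[ξ n | m n] =ᵐ[μ] 0 := fun n => by
    have := hrun.condExp_excessNoise hD n.divNat n.modNat
    rwa [hindex n] at this
  have htail := measureReal_le_sum_le hmono (fun n => 𝓕.le _) (Nat.cast_pos.2 hH) hpos hmeas
    (fun n ω => ConfidenceData.abs_excessNoise_le ..) hcond hδ hδ1
  set E := {ω | (H : ℝ) * Real.sqrt (2 * (K * H : ℕ) * Real.log (1 / δ)) ≤ ∑ n, ξ n ω}
  have hE : MeasurableSet E := measurableSet_le measurable_const
    (Finset.measurable_sum _ fun n _ => (hmeas n).mono (𝓕.le _) le_rfl)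
  refine ⟨Eᶜ, hE.compl, ?_, fun ω hω => (lt_of_not_ge fun h => hω h).le⟩
  rw [probReal_compl_eq_one_sub hE]
  linarith

end IsEpisodicInteraction

end

theorem mainTheorem3 {S A I Ω : Type*} [Fintype S] [Fintype A] [Nonempty A] [Fintype I]
    {mΩ : MeasurableSpace Ω} (μ : MeasureTheory.Measure Ω) [MeasureTheory.IsProbabilityMeasure μ]
    (H K : ℕ) (M : EpisodicMDP S A H)
    (𝓕 : MeasureTheory.Filtration ℕ mΩ)
    (x : Fin K → Fin (H + 1) → Ω → S) (π : Fin K → Ω → Fin H → S → A)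
    (D : Fin K → Ω → ConfidenceData S A I H)
    (hrun : IsEpisodicInteraction M μ 𝓕 x π)
    (hD : IsPredictableConfidence 𝓕 D)
    (hπ : ∀ t ω, (D t ω).confidenceSet.Nonempty → (D t ω).IsOptimisticPolicy M (π t ω))
    (δ : ℝ) (hδ : 0 < δ) (hδ1 : δ ≤ 1) :
    ∃ G : Set Ω, MeasurableSet G ∧ 1 - 2 * δ ≤ μ.real G ∧
      ∀ ω ∈ G, (∀ t, M.trans ∈ (D t ω).confidenceSet) →
        regret M x π ω ≤
          (∑ t, ∑ h : Fin H,
            (D t ω).bonus M h (x t h.castSucc ω) (π t ω h (x t h.castSucc ω)))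
          + (∑ t, ∑ h : Fin H,
            (D t ω).transitionGap M h (x t h.castSucc ω) (π t ω h (x t h.castSucc ω)))
          + 2 * H * Real.sqrt (2 * (K * H : ℕ) * Real.log (1 / δ)) := by
  obtain ⟨G, hG, hμG, hnoise⟩ := hrun.exists_sum_excessNoise_le hD hδ hδ1
  refine ⟨G, hG, by linarith, fun ω hω hconf => ?_⟩
  have hregret : regret M x π ω ≤ ∑ t, ((D t ω).optimisticValue M 0 (x t 0 ω) -
      M.policyValue (π t ω) 0 (x t 0 ω)) := by
    refine Finset.sum_le_sum fun t _ => ?_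
    rw [M.value_eq_policyValue]
    -- Optimism holds for all policies at once, so it passes to the supremum.
    refine sub_le_sub_right (ciSup_le fun p => ?_) _
    rw [M.value_eq_policyValue]
    exact ConfidenceData.policyValue_le_optimisticValue (hconf t) p 0 _
  rw [Finset.sum_congr rfl fun t _ => ConfidenceData.optimisticValue_sub_policyValue (hconf t)
    (hπ t ω ⟨_, hconf t⟩) fun h => x t h ω, Finset.sum_add_distrib,
    Finset.sum_add_distrib] at hregret
  -- The noise bound uses one copy of this term; nonnegativity absorbs the second copy in the claim.
  have hroot : 0 ≤ H * Real.sqrt (2 * (K * H : ℕ) * Real.log (1 / δ)) := by positivity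
  linarith [hnoise ω hω]
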